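/- Let $\mathcal H_A,\mathcal H_B$ be finite-dimensional Hilbert spaces and let $\rho$ be a quantum state on $\mathcal H_A\otimes\mathcal H_B$. For $\varepsilon\in[0,1]$ the probabilistic approximate distillable entanglement $E_d^{\varepsilon}(\rho)$ is the supremum of $p\log_2 d$ over all $p\in[0,1]$, all integers $d\ge 1$, and all LOCC channels $\mathcal L$ (finite compositions of one-way LOCC channels) from $\mathcal H_A\otimes\mathcal H_B$ to $\mathcal H_X\otimes\mathcal H_{\hat A}\otimes\mathcal H_{\hat B}$, where $\mathcal H_X=\mathbb C^2$ and $\dim\mathcal H_{\hat A}=\dim\mathcal H_{\hat B}=d$, for which there are states $\widetilde\Phi^{d},\sigma$ on $\mathcal H_{\hat A}\otimes\mathcal H_{\hat B}$ with $$\mathcal L(\rho)=p\,|1\rangle\langle 1|\otimes\widetilde\Phi^{d}+(1-p)\,|0\rangle\langle 0|\otimes\sigma,\qquad F(\widetilde\Phi^{d},\Phi^{d})\ge 1-\varepsilon .$$ Here $\Phi^{d}=|\Phi^d\rangle\langle\Phi^d|$ with $|\Phi^d\rangle=d^{-1/2}\sum_i|i\rangle|i\rangle$, and $F(\omega,\tau)=\|\sqrt\omega\sqrt\tau\|_1^2$.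 The classical flag $X$ is held by Alice (the holder of $A$), who also holds $\hat A$, while Bob holds $\hat B$. Tensor powers $\rho^{\otimes n}$ are regarded as bipartite with respect to the cut $A_1\cdots A_n\,|\,B_1\cdots B_n$. Define $$E_d(\rho)=\inf_{\varepsilon\in(0,1)}\liminf_{n\to\infty}\tfrac1nE_d^{\varepsilon}(\rho^{\otimes n}),\qquad \widetilde E_d(\rho)=\sup_{\varepsilon\in(0,1)}\limsup_{n\to\infty}\tfrac1nE_d^{\varepsilon}(\rho^{\otimes n}).$$ Then for every $\varepsilon\in(0,1)$, $$0\le E_d^{\varepsilon}(\rho)\le\log_2 D+\log_2\frac1{1-\varepsilon},\qquad D=\min\{\dim\mathcal H_A,\dim\mathcal H_B\}.$$ For every $\varepsilon\in(0,1)$ and every integer $\ell\ge1$, $$\liminf_{n\to\infty}\tfrac1nE_d^{\varepsilon}(\rho^{\otimes n})=\tfrac1\ell\liminf_{n\to\infty}\tfrac1nE_d^{\varepsilon}\big((\rho^{\otimes\ell})^{\otimes n}\big),\qquad \limsup_{n\to\infty}\tfrac1nE_d^{\varepsilon}(\rho^{\otimes n})=\tfrac1\ell\limsup_{n\to\infty}\tfrac1nE_d^{\varepsilon}\big((\rho^{\otimes\ell})^{\otimes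 n}\big).$$ Consequently, for every integer $\ell\ge1$, $E_d(\rho)=\frac1\ell E_d(\rho^{\otimes\ell})$ and $\widetilde E_d(\rho)=\frac1\ell\widetilde E_d(\rho^{\otimes\ell})$. -/

import Mathlib

open Filter
open scoped Kronecker ComplexOrder

/-! ### States and fidelity

A finite-dimensional Hilbert space with a fixed orthonormal basis labelled by a finite type `A`
is `ℂ^A`; operators on it are matrices indexed by `A`, and `ℂ^A ⊗ ℂ^B` has the label type `A × B`. -/

/-- Quantum states (density matrices): positive semidefinite matrices of unit trace. -/
def IsState {A : Type} [Fintype A] (ρ : Matrix A A ℂ) : Prop :=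
  ρ.PosSemidef ∧ ρ.trace = 1

/-- The positive semidefinite square root of a positive semidefinite matrix. -/
noncomputable def psdSqrt {A : Type} [Fintype A] [DecidableEq A] (ω : Matrix A A ℂ) :
    Matrix A A ℂ :=
  cfc Real.sqrt ω

/-- The trace norm `‖M‖₁ = Tr √(M† M)`. -/
noncomputable def traceNorm {A : Type} [Fintype A] [DecidableEq A] (M : Matrix A A ℂ) : ℝ :=
  (psdSqrt (M.conjTranspose * M)).trace.re

/-- The (squared) fidelity `F(ω, τ) = ‖√ω √τ‖₁²`. -/
noncomputable def fidelity {A : Type} [Fintype A] [DecidableEq A] (ω τ : Matrix A A ℂ) : ℝ :=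
  traceNorm (psdSqrt ω * psdSqrt τ) ^ 2

/-- The maximally entangled vector `d^{-1/2} ∑ i, |i⟩|i⟩`. -/
noncomputable def maxEntVec (d : ℕ) : Fin d × Fin d → ℂ :=
  fun i => if i.1 = i.2 then (((Real.sqrt d)⁻¹ : ℝ) : ℂ) else 0

/-- The maximally entangled state `Φ^d = |Φ^d⟩⟨Φ^d|`. -/
noncomputable def maxEnt (d : ℕ) : Matrix (Fin d × Fin d) (Fin d × Fin d) ℂ :=
  Matrix.vecMulVec (maxEntVec d) (star (maxEntVec d))

/-- The tensor power `ρ^{⊗ n}` of a bipartite operator, as a bipartite operator with respect to the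
cut `A₁ ⋯ Aₙ | B₁ ⋯ Bₙ`. -/
def tensorPow {A B : Type} (ρ : Matrix (A × B) (A × B) ℂ) (n : ℕ) :
    Matrix ((Fin n → A) × (Fin n → B)) ((Fin n → A) × (Fin n → B)) ℂ :=
  fun i j => ∏ t, ρ (i.1 t, i.2 t) (j.1 t, j.2 t)

/-! ### LOCC channels -/

/-- A quantum instrument from `ℂ^A` to `ℂ^A'` in operator-sum (Kraus) form: the completely positive
map with outcome `x` is `X ↦ ∑ j, K x j * X * (K x j)†`, and the sum of these maps over all
outcomes is trace preserving. -/
def IsInstrument {A A' : Type} [DecidableEq A] [Fintype A'] {r s : ℕ}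
    (K : Fin r → Fin s → Matrix A' A ℂ) : Prop :=
  ∑ x, ∑ j, (K x j).conjTranspose * K x j = 1

/-- A quantum channel from `ℂ^A` to `ℂ^A'` in operator-sum (Kraus) form: the completely positive
trace-preserving map `X ↦ ∑ j, K j * X * (K j)†`. -/
def IsChannel {A A' : Type} [DecidableEq A] [Fintype A'] {s : ℕ}
    (K : Fin s → Matrix A' A ℂ) : Prop :=
  ∑ j, (K j).conjTranspose * K j = 1

/-- The map `∑ x, 𝒦 x ⊗ 𝓛 x`, where `𝒦 x` and `𝓛 x` are the completely positive maps with Kraus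
operators `K x j` and `L x k` respectively. -/
def sumTensorMap {A B A' B' : Type} [Fintype A] [Fintype B] {r s t : ℕ}
    (K : Fin r → Fin s → Matrix A' A ℂ) (L : Fin r → Fin t → Matrix B' B ℂ)
    (X : Matrix (A × B) (A × B) ℂ) : Matrix (A' × B') (A' × B') ℂ :=
  ∑ x, ∑ j, ∑ k, (K x j ⊗ₖ L x k) * X * (K x j ⊗ₖ L x k).conjTranspose

/-- LOCC channels: finite compositions of one-way LOCC channels.  In a one-way channel one party
applies an instrument, sends the classical outcome `x` to the other party, who then applies a
channel depending on `x`. -/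
inductive IsLOCC : {A B A' B' : Type} → [Fintype A] → [DecidableEq A] → [Fintype B] →
    [DecidableEq B] → [Fintype A'] → [DecidableEq A'] → [Fintype B'] → [DecidableEq B'] →
    (Matrix (A × B) (A × B) ℂ → Matrix (A' × B') (A' × B') ℂ) → Prop
  | aliceToBob {A B A' B' : Type} [Fintype A] [DecidableEq A] [Fintype B] [DecidableEq B]
      [Fintype A'] [DecidableEq A'] [Fintype B'] [DecidableEq B'] {r s t : ℕ}
      (K : Fin r → Fin s → Matrix A' A ℂ) (L : Fin r → Fin t → Matrix B' B ℂ)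
      (hK : IsInstrument K) (hL : ∀ x, IsChannel (L x)) : IsLOCC (sumTensorMap K L)
  | bobToAlice {A B A' B' : Type} [Fintype A] [DecidableEq A] [Fintype B] [DecidableEq B]
      [Fintype A'] [DecidableEq A'] [Fintype B'] [DecidableEq B'] {r s t : ℕ}
      (K : Fin r → Fin s → Matrix A' A ℂ) (L : Fin r → Fin t → Matrix B' B ℂ)
      (hK : ∀ x, IsChannel (K x)) (hL : IsInstrument L) : IsLOCC (sumTensorMap K L)
  | comp {A B C D A' B' : Type} [Fintype A] [DecidableEq A] [Fintype B] [DecidableEq B]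
      [Fintype C] [DecidableEq C] [Fintype D] [DecidableEq D]
      [Fintype A'] [DecidableEq A'] [Fintype B'] [DecidableEq B']
      (Λ₂ : Matrix (C × D) (C × D) ℂ → Matrix (A' × B') (A' × B') ℂ)
      (Λ₁ : Matrix (A × B) (A × B) ℂ → Matrix (C × D) (C × D) ℂ)
      (h₂ : IsLOCC Λ₂) (h₁ : IsLOCC Λ₁) : IsLOCC (Λ₂ ∘ Λ₁)

/-! ### Probabilistic approximate distillable entanglement -/

/-- The state `p |1⟩⟨1| ⊗ Φ' + (1 - p) |0⟩⟨0| ⊗ σ` on `X Â B̂`.  The classical flag `X` is held by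
Alice, so that the bipartite cut is `X Â | B̂`. -/
noncomputable def flaggedState {d : ℕ} (p : ℝ) (Φ' σ : Matrix (Fin d × Fin d) (Fin d × Fin d) ℂ) :
    Matrix ((Fin 2 × Fin d) × Fin d) ((Fin 2 × Fin d) × Fin d) ℂ :=
  ((p : ℂ) • (Matrix.single (1 : Fin 2) (1 : Fin 2) (1 : ℂ) ⊗ₖ Φ')
    + ((1 - p : ℝ) : ℂ) • (Matrix.single (0 : Fin 2) (0 : Fin 2) (1 : ℂ) ⊗ₖ σ)).submatrix
      (Equiv.prodAssoc (Fin 2) (Fin d) (Fin d)) (Equiv.prodAssoc (Fin 2) (Fin d) (Fin d))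

/-- The non-asymptotic probabilistic approximate distillable entanglement `E_d^ε(ρ)`. -/
noncomputable def pade {A B : Type} [Fintype A] [DecidableEq A] [Fintype B] [DecidableEq B]
    (ε : ℝ) (ρ : Matrix (A × B) (A × B) ℂ) : EReal :=
  sSup {e : EReal | ∃ (p : ℝ) (d : ℕ)
    (Λ : Matrix (A × B) (A × B) ℂ →
      Matrix ((Fin 2 × Fin d) × Fin d) ((Fin 2 × Fin d) × Fin d) ℂ)
    (Φ' σ : Matrix (Fin d × Fin d) (Fin d × Fin d) ℂ),
      0 ≤ p ∧ p ≤ 1 ∧ 1 ≤ d ∧ IsLOCC Λ ∧ IsState Φ' ∧ IsState σ ∧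
      Λ ρ = flaggedState p Φ' σ ∧ 1 - ε ≤ fidelity Φ' (maxEnt d) ∧
      e = ((p * Real.logb 2 d : ℝ) : EReal)}

/-- The asymptotic probabilistic approximate distillable entanglement `E_d(ρ)`. -/
noncomputable def asympPade {A B : Type} [Fintype A] [DecidableEq A] [Fintype B] [DecidableEq B]
    (ρ : Matrix (A × B) (A × B) ℂ) : EReal :=
  ⨅ ε ∈ Set.Ioo (0 : ℝ) 1,
    liminf (fun n : ℕ => ((1 / (n : ℝ) : ℝ) : EReal) * pade ε (tensorPow ρ n)) atTop

/-- The strong converse probabilistic approximate distillable entanglement `Ẽ_d(ρ)`. -/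
noncomputable def strongConversePade {A B : Type} [Fintype A] [DecidableEq A] [Fintype B]
    [DecidableEq B] (ρ : Matrix (A × B) (A × B) ℂ) : EReal :=
  ⨆ ε ∈ Set.Ioo (0 : ℝ) 1,
    limsup (fun n : ℕ => ((1 / (n : ℝ) : ℝ) : EReal) * pade ε (tensorPow ρ n)) atTop

/-!
The upper bound rests on separability. An LOCC channel has Kraus operators of product form
(`IsLOCC.exists_product_kraus`), and compressing to the flag value `1` keeps this form. A product
operator maps a vector of `ℂ^A ⊗ ℂ^B` to a vector of Schmidt rank at most `D`, the smaller of the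
two dimensions, and a vector of Schmidt rank `r` has squared overlap at most `r / d` times its
squared norm with `Φ^d` (`normSq_overlap_le`, a Cauchy–Schwarz estimate). So the unnormalized
success state `p Φ'` has overlap at most `p D / d` with `Φ^d`. As the fidelity with a pure state is
an expectation value (`fidelity_vecMulVec`), `1 - ε ≤ D / d` whenever `p > 0`
(`fidelity_le_of_locc`), which gives `p log₂ d ≤ log₂ D + log₂ (1 / (1 - ε))`. Nonnegativity comes
from preparing the product state `Φ^1`.

For the regularized quantities, `pade` does not increase under LOCC (`pade_map_le`). Discarding
copies shows that `a n = pade ε (tensorPow ρ n)` is nondecreasing (`pade_tensorPow_mono`),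
regrouping copies is a local relabelling, so that `tensorPow (tensorPow ρ ℓ) n` and
`tensorPow ρ (ℓ * n)` have the same distillable entanglement (`pade_tensorPow_tensorPow`), and the
upper bound gives `a n ≤ C n`. For such a sequence the rate `a n / n` changes by at most `C ℓ / n`
between `n` and a neighbouring multiple of `ℓ`, so its limits inferior and superior may be taken
along multiples of `ℓ` (`regularized_multiples`). Multiplication by `1 / ℓ` commutes with the
infimum and the supremum over `ε`.
-/

/-! ### Upper and lower growth rates along multiples -/

/-- Multiplication by a positive real number, as an order automorphism of the extended reals. It
commutes with all infima, suprema and limits inferior and superior. -/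
noncomputable def erealMulLeft (c : ℝ) (hc : 0 < c) : EReal ≃o EReal :=
  Equiv.toOrderIso
    { toFun := fun x => (c : EReal) * x
      invFun := fun x => ((c⁻¹ : ℝ) : EReal) * x
      left_inv := fun x => by
        beta_reduce
        rw [← mul_assoc, ← EReal.coe_mul, inv_mul_cancel₀ hc.ne', EReal.coe_one, one_mul]
      right_inv := fun x => by
        beta_reduce
        rw [← mul_assoc, ← EReal.coe_mul, mul_inv_cancel₀ hc.ne', EReal.coe_one, one_mul] }
    (fun _ _ h => mul_le_mul_of_nonneg_left h (EReal.coe_nonneg.2 hc.le))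
    (fun _ _ h => mul_le_mul_of_nonneg_left h (EReal.coe_nonneg.2 (inv_pos.2 hc).le))

theorem erealMulLeft_apply (c : ℝ) (hc : 0 < c) (x : EReal) :
    erealMulLeft c hc x = (c : EReal) * x := rfl

/-- Passing from `n` to the next multiple `N` of `ℓ` costs at most `C ℓ / n` in the rate, because
`b n ≤ b N` and `b N / n - b N / N = (b N / N) (N - n) / n`. -/
theorem rate_le_next_multiple {b : ℕ → ℝ} {C : ℝ} (hb : Monotone b)
    (hC : ∀ n, 1 ≤ n → b n ≤ C * n) (hC0 : 0 ≤ C) {ℓ n : ℕ} (hℓ : 1 ≤ ℓ) (hn : 1 ≤ n) :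
    b n / n ≤ b (ℓ * (n / ℓ + 1)) / (ℓ * (n / ℓ + 1) : ℕ) + C * ℓ / n := by
  set N := ℓ * (n / ℓ + 1) with hN
  have h1 : n ≤ N := (Nat.lt_mul_div_succ n hℓ).le
  have h2 : N ≤ n + ℓ := by
    have := Nat.mul_div_le n ℓ
    rw [hN, mul_add]; omega
  have h1' : (n : ℝ) ≤ N := by exact_mod_cast h1
  have h2' : (N : ℝ) ≤ n + ℓ := by exact_mod_cast h2
  have hn' : (0 : ℝ) < n := by exact_mod_cast hn
  have hN' : (0 : ℝ) < N := by linarith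
  have hCN := hC N (hn.trans h1)
  have hbn := hb h1
  rw [div_add_div _ _ hN'.ne' hn'.ne', div_le_div_iff₀ hn' (by positivity)]
  have : b N * (N - n) ≤ C * N * ℓ :=
    mul_le_mul hCN (by linarith) (by linarith) (by positivity)
  have h3 : b n * N ≤ b N * N := mul_le_mul_of_nonneg_right hbn hN'.le
  calc b n * (N * n) = (b n * N) * n := by ring
    _ ≤ (b N * n + N * (C * ℓ)) * n := mul_le_mul_of_nonneg_right (by linarith) hn'.le

theorem prev_multiple_rate_le {b : ℕ → ℝ} {C : ℝ} (hb : Monotone b)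
    (hC : ∀ n, 1 ≤ n → b n ≤ C * n) (hC0 : 0 ≤ C) {ℓ n : ℕ} (hℓ : 1 ≤ ℓ) (hn : ℓ ≤ n) :
    b (ℓ * (n / ℓ)) / (ℓ * (n / ℓ) : ℕ) ≤ b n / n + C * ℓ / n := by
  set N := ℓ * (n / ℓ) with hN
  have h1 : N ≤ n := Nat.mul_div_le n ℓ
  have h2 : n ≤ N + ℓ := by
    have := Nat.lt_mul_div_succ n hℓ
    rw [mul_add] at this; omega
  have h0 : 1 ≤ N := Nat.mul_pos hℓ (Nat.div_pos hn hℓ)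
  have h1' : (N : ℝ) ≤ n := by exact_mod_cast h1
  have h2' : (n : ℝ) ≤ N + ℓ := by exact_mod_cast h2
  have hN' : (0 : ℝ) < N := by exact_mod_cast h0
  have hn' : (0 : ℝ) < n := by linarith
  have hCN := hC N h0
  have hbn := hb h1
  rw [← add_div, div_le_div_iff₀ hN' hn']
  have : b N * (n - N) ≤ C * N * ℓ :=
    mul_le_mul hCN (by linarith) (by linarith) (by positivity)
  have h3 : b N * N ≤ b n * N := mul_le_mul_of_nonneg_right hbn hN'.le
  linarith

theorem tendsto_coe_const_div (C : ℝ) :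
    Tendsto (fun n : ℕ => ((C / n : ℝ) : EReal)) atTop (nhds 0) := by
  have := (tendsto_const_div_atTop_nhds_zero_nat C)
  exact (continuous_coe_real_ereal.tendsto 0).comp this

/-- The limit superior of `b n / n` for a monotone sequence `b` of at most linear growth may be
computed along the multiples of `ℓ`, since consecutive multiples differ by a bounded amount. -/
theorem limsup_rate_multiples {b : ℕ → ℝ} {C : ℝ} (hb : Monotone b)
    (hC : ∀ n, 1 ≤ n → b n ≤ C * n) (hC0 : 0 ≤ C) {ℓ : ℕ} (hℓ : 1 ≤ ℓ) :
    limsup (fun n : ℕ => ((b n / n : ℝ) : EReal)) atTop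
      = limsup (fun m : ℕ => ((b (ℓ * m) / (ℓ * m : ℕ) : ℝ) : EReal)) atTop := by
  apply le_antisymm
  · have hg : Tendsto (fun n : ℕ => n / ℓ + 1) atTop atTop :=
      (tendsto_add_atTop_nat 1).comp (Nat.tendsto_div_const_atTop (by omega))
    have h0 := (tendsto_coe_const_div (C * ℓ)).limsup_eq
    refine le_trans ?_ (hg.limsup_comp_le_limsup
      (u := fun m : ℕ => ((b (ℓ * m) / (ℓ * m : ℕ) : ℝ) : EReal)))
    refine le_trans (limsup_le_limsup (v := (fun n : ℕ =>
      ((b (ℓ * (n / ℓ + 1)) / (ℓ * (n / ℓ + 1) : ℕ) : ℝ) : EReal))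
        + fun n : ℕ => ((C * ℓ / n : ℝ) : EReal)) ?_) ?_
    · filter_upwards [eventually_ge_atTop 1] with n hn
      simp only [Pi.add_apply, ← EReal.coe_add]
      exact EReal.coe_le_coe_iff.2 (rate_le_next_multiple hb hC hC0 hℓ hn)
    · refine (EReal.limsup_add_le (by simp [h0]) (by simp [h0])).trans ?_
      rw [h0, add_zero]
      rfl
  -- A subsequence has the smaller limit superior and the larger limit inferior.
  · exact (tendsto_id.const_mul_atTop' hℓ).limsup_comp_le_limsup
      (u := fun n : ℕ => ((b n / n : ℝ) : EReal))

/-- The counterpart of `limsup_rate_multiples` for the limit inferior. -/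
theorem liminf_rate_multiples {b : ℕ → ℝ} {C : ℝ} (hb : Monotone b)
    (hC : ∀ n, 1 ≤ n → b n ≤ C * n) (hC0 : 0 ≤ C) {ℓ : ℕ} (hℓ : 1 ≤ ℓ) :
    liminf (fun n : ℕ => ((b n / n : ℝ) : EReal)) atTop
      = liminf (fun m : ℕ => ((b (ℓ * m) / (ℓ * m : ℕ) : ℝ) : EReal)) atTop := by
  apply le_antisymm
  · exact (tendsto_id.const_mul_atTop' hℓ).liminf_le_liminf_comp
      (u := fun n : ℕ => ((b n / n : ℝ) : EReal))
  · have hg : Tendsto (fun n : ℕ => n / ℓ) atTop atTop := Nat.tendsto_div_const_atTop (by omega)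
    have h0 := (tendsto_coe_const_div (-(C * ℓ))).liminf_eq
    refine le_trans (hg.liminf_le_liminf_comp
      (u := fun m : ℕ => ((b (ℓ * m) / (ℓ * m : ℕ) : ℝ) : EReal))) ?_
    refine le_trans ?_ (liminf_le_liminf (u := (fun n : ℕ =>
      ((b (ℓ * (n / ℓ)) / (ℓ * (n / ℓ) : ℕ) : ℝ) : EReal))
        + fun n : ℕ => ((-(C * ℓ) / n : ℝ) : EReal)) ?_)
    · refine le_trans ?_ EReal.le_liminf_add
      rw [h0, add_zero]
      rfl
    · filter_upwards [eventually_ge_atTop ℓ] with n hn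
      simp only [Pi.add_apply, ← EReal.coe_add]
      refine EReal.coe_le_coe_iff.2 ?_
      have := prev_multiple_rate_le hb hC hC0 hℓ hn
      rw [neg_div]
      linarith

theorem one_div_mul_one_div_mul {ℓ : ℕ} (m : ℕ) (x : ℝ) :
    ((1 / (ℓ : ℝ) : ℝ) : EReal) * (((1 / (m : ℝ) : ℝ) : EReal) * (x : EReal))
      = ((x / (ℓ * m : ℕ) : ℝ) : EReal) := by
  rw [← EReal.coe_mul, ← EReal.coe_mul]
  congr 1
  push_cast
  ring

/-- For a monotone nonnegative sequence of at most linear growth, regularizing along multiples of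
`ℓ` multiplies both asymptotic rates by `ℓ`. -/
theorem regularized_multiples {a : ℕ → EReal} {C : ℝ} (ha : Monotone a)
    (ha0 : ∀ n, 0 ≤ a n) (hC : ∀ n, 1 ≤ n → a n ≤ ((C * n : ℝ) : EReal)) (hC0 : 0 ≤ C) {ℓ : ℕ}
    (hℓ : 1 ≤ ℓ) :
    liminf (fun n : ℕ => ((1 / (n : ℝ) : ℝ) : EReal) * a n) atTop
      = ((1 / (ℓ : ℝ) : ℝ) : EReal)
        * liminf (fun m : ℕ => ((1 / (m : ℝ) : ℝ) : EReal) * a (ℓ * m)) atTop ∧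
    limsup (fun n : ℕ => ((1 / (n : ℝ) : ℝ) : EReal) * a n) atTop
      = ((1 / (ℓ : ℝ) : ℝ) : EReal)
        * limsup (fun m : ℕ => ((1 / (m : ℝ) : ℝ) : EReal) * a (ℓ * m)) atTop := by
  have hne : ∀ n, a n ≠ ⊤ := fun n => by
    have h1 := (ha (Nat.le_succ n)).trans (hC (n + 1) (by omega))
    exact (h1.trans_lt (EReal.coe_lt_top _)).ne
  obtain ⟨b, rfl⟩ : ∃ b : ℕ → ℝ, a = fun n => (b n : EReal) :=
    ⟨fun n => (a n).toReal, funext fun n => (EReal.coe_toReal (hne n)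
      (fun h => by simpa [h] using ha0 n)).symm⟩
  have hb : Monotone b := fun i j h => EReal.coe_le_coe_iff.1 (ha h)
  have hbC : ∀ n, 1 ≤ n → b n ≤ C * n := fun n h => EReal.coe_le_coe_iff.1 (hC n h)
  have hc : (0 : ℝ) < 1 / ℓ := by positivity
  have hn : ∀ n : ℕ, ((1 / (n : ℝ) : ℝ) : EReal) * (b n : EReal) = ((b n / n : ℝ) : EReal) :=
    fun n => by rw [← EReal.coe_mul, one_div_mul_eq_div]
  simp only [hn]
  rw [← erealMulLeft_apply _ hc, ← erealMulLeft_apply _ hc, OrderIso.liminf_apply,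
    OrderIso.limsup_apply]
  simp only [erealMulLeft_apply, one_div_mul_one_div_mul]
  exact ⟨liminf_rate_multiples hb hbC hC0 hℓ, limsup_rate_multiples hb hbC hC0 hℓ⟩

/-! ### Local relabelling, discarding, and monotonicity -/

theorem pade_map_le {A B A' B' : Type} [Fintype A] [DecidableEq A] [Fintype B] [DecidableEq B]
    [Fintype A'] [DecidableEq A'] [Fintype B'] [DecidableEq B'] (ε : ℝ)
    {Λ : Matrix (A × B) (A × B) ℂ → Matrix (A' × B') (A' × B') ℂ} (hΛ : IsLOCC Λ)
    (X : Matrix (A × B) (A × B) ℂ) : pade ε (Λ X) ≤ pade ε X := by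
  refine sSup_le_sSup ?_
  rintro e ⟨p, d, Λ', Φ', σ, h0, h1, hd, hΛ', hΦ, hσ, h, hF, he⟩
  exact ⟨p, d, Λ' ∘ Λ, Φ', σ, h0, h1, hd, hΛ'.comp _ _ hΛ, hΦ, hσ, h, hF, he⟩

/-- The operator `⟨j|` on the second factor of `A × A'`, precomposed with the relabelling
`e : A₁ ≃ A × A'`; these are the Kraus operators of discarding `A'`. -/
def discardKraus {A₁ A A' : Type} [DecidableEq A₁] (e : A₁ ≃ A × A') (j : A') :
    Matrix A A₁ ℂ :=
  (1 : Matrix A₁ A₁ ℂ).submatrix (fun a => e.symm (a, j)) id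

theorem discardKraus_apply {A₁ A A' : Type} [DecidableEq A₁] (e : A₁ ≃ A × A') (j : A') (a : A)
    (b : A₁) : discardKraus e j a b = if e.symm (a, j) = b then 1 else 0 := rfl

theorem sum_discardKraus {A₁ A A' : Type} [DecidableEq A₁] [Fintype A] [Fintype A']
    (e : A₁ ≃ A × A') :
    ∑ j, (discardKraus e j).conjTranspose * discardKraus e j = 1 := by
  ext a b
  simp only [Matrix.sum_apply, Matrix.mul_apply, Matrix.conjTranspose_apply, discardKraus_apply]
  rw [← Fintype.sum_prod_type_right' (f := fun (x : A) (y : A') =>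
    star (if e.symm (x, y) = a then (1 : ℂ) else 0) * if e.symm (x, y) = b then 1 else 0)]
  classical
  rw [Fintype.sum_eq_single (e a)]
  · simp [Matrix.one_apply]
  · intro x hx
    have : e.symm x ≠ a := fun h => hx (by rw [← h, e.apply_symm_apply])
    simp [this]

theorem discardKraus_conj_apply {A₁ A A' B₁ B B' : Type} [Fintype A₁] [DecidableEq A₁]
    [Fintype B₁] [DecidableEq B₁] (e : A₁ ≃ A × A') (f : B₁ ≃ B × B')
    (X : Matrix (A₁ × B₁) (A₁ × B₁) ℂ) (x : A') (y : B') (i i' : A × B) :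
    ((discardKraus e x ⊗ₖ discardKraus f y) * X *
      (discardKraus e x ⊗ₖ discardKraus f y).conjTranspose) i i'
      = X (e.symm (i.1, x), f.symm (i.2, y)) (e.symm (i'.1, x), f.symm (i'.2, y)) := by
  have h : discardKraus e x ⊗ₖ discardKraus f y
      = (1 : Matrix (A₁ × B₁) (A₁ × B₁) ℂ).submatrix
        (fun i : A × B => (e.symm (i.1, x), f.symm (i.2, y))) id := by
    rw [← Matrix.one_kronecker_one]
    rfl
  rw [h, Matrix.conjTranspose_submatrix, Matrix.conjTranspose_one]
  simp [Matrix.mul_apply, Matrix.one_apply]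

/-- Discarding the local subsystems `A'` and `B'` is an LOCC channel, so it does not increase the
distillable entanglement. The subsystems are specified by relabellings of the two local bases. -/
theorem pade_partialTrace_le {A₁ A A' B₁ B B' : Type} [Fintype A₁] [DecidableEq A₁] [Fintype A]
    [DecidableEq A] [Fintype A'] [Fintype B₁] [DecidableEq B₁] [Fintype B] [DecidableEq B]
    [Fintype B'] (ε : ℝ) (e : A₁ ≃ A × A') (f : B₁ ≃ B × B')
    (X : Matrix (A₁ × B₁) (A₁ × B₁) ℂ) (Y : Matrix (A × B) (A × B) ℂ)
    (h : ∀ i i', Y i i' = ∑ x, ∑ y,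
      X (e.symm (i.1, x), f.symm (i.2, y)) (e.symm (i'.1, x), f.symm (i'.2, y))) :
    pade ε Y ≤ pade ε X := by
  let K : Fin 1 → Fin (Fintype.card A') → Matrix A A₁ ℂ :=
    fun _ j => discardKraus e ((Fintype.equivFin A').symm j)
  let L : Fin 1 → Fin (Fintype.card B') → Matrix B B₁ ℂ :=
    fun _ j => discardKraus f ((Fintype.equivFin B').symm j)
  have hK : IsInstrument K := by
    simp only [IsInstrument, K, Finset.univ_unique, Finset.sum_const, Finset.card_singleton,
      one_smul]
    rw [← sum_discardKraus e]
    exact Equiv.sum_comp (Fintype.equivFin A').symm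
      (fun j => (discardKraus e j).conjTranspose * discardKraus e j)
  have hL : ∀ x, IsChannel (L x) := fun _ => by
    rw [IsChannel, ← sum_discardKraus f]
    exact Equiv.sum_comp (Fintype.equivFin B').symm
      (fun j => (discardKraus f j).conjTranspose * discardKraus f j)
  have hY : Y = sumTensorMap K L X := by
    ext i i'
    simp only [sumTensorMap, Finset.univ_unique, Finset.sum_singleton, Matrix.sum_apply, K, L,
      discardKraus_conj_apply]
    rw [h, ← Equiv.sum_comp (Fintype.equivFin A').symm]
    refine Finset.sum_congr rfl fun x _ => ?_
    rw [← Equiv.sum_comp (Fintype.equivFin B').symm]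
  rw [hY]
  exact pade_map_le ε (IsLOCC.aliceToBob K L hK hL) X

theorem pade_submatrix_le {A₁ A B₁ B : Type} [Fintype A₁] [DecidableEq A₁] [Fintype A]
    [DecidableEq A] [Fintype B₁] [DecidableEq B₁] [Fintype B] [DecidableEq B]
    (ε : ℝ) (e : A ≃ A₁) (f : B ≃ B₁) (X : Matrix (A₁ × B₁) (A₁ × B₁) ℂ) :
    pade ε (X.submatrix (Prod.map e f) (Prod.map e f)) ≤ pade ε X :=
  pade_partialTrace_le ε (e.symm.trans (Equiv.prodPUnit A).symm)
    (f.symm.trans (Equiv.prodPUnit B).symm) X _ fun i i' => by simp [Prod.map]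

theorem pade_submatrix {A₁ A B₁ B : Type} [Fintype A₁] [DecidableEq A₁] [Fintype A]
    [DecidableEq A] [Fintype B₁] [DecidableEq B₁] [Fintype B] [DecidableEq B]
    (ε : ℝ) (e : A ≃ A₁) (f : B ≃ B₁) (X : Matrix (A₁ × B₁) (A₁ × B₁) ℂ) :
    pade ε (X.submatrix (Prod.map e f) (Prod.map e f)) = pade ε X := by
  refine le_antisymm (pade_submatrix_le ε e f X) ?_
  convert pade_submatrix_le ε e.symm f.symm (X.submatrix (Prod.map e f) (Prod.map e f))
  ext i i'
  simp [Prod.map]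

/-! ### Tensor powers -/

/-- Distributivity over product labels: a sum over pairs of sequences of a product over the
positions factors into sums over single pairs. -/
theorem sum_prod_pairs {A B : Type} [Fintype A] [Fintype B] (n : ℕ) (g : Fin n → A × B → ℂ) :
    ∑ i : (Fin n → A) × (Fin n → B), ∏ t, g t (i.1 t, i.2 t) = ∏ t, ∑ c, g t c := by
  classical
  rw [Fintype.prod_sum]
  exact Fintype.sum_equiv (Equiv.arrowProdEquivProdArrow (Fin n) (fun _ => A) (fun _ => B)).symm
    _ _ fun i => rfl

theorem trace_tensorPow {A B : Type} [Fintype A] [Fintype B] (ρ : Matrix (A × B) (A × B) ℂ)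
    (n : ℕ) : (tensorPow ρ n).trace = ρ.trace ^ n := by
  have := sum_prod_pairs n (fun _ c => ρ c c)
  simpa [Matrix.trace, tensorPow] using this

theorem exists_eq_mul_conjTranspose {A : Type} [Fintype A] {X : Matrix A A ℂ}
    (hX : X.PosSemidef) : ∃ C : Matrix A A ℂ, X = C * C.conjTranspose := by
  classical
  open scoped MatrixOrder in
  obtain ⟨C, hC⟩ := CStarAlgebra.nonneg_iff_eq_mul_star_self.1 hX.nonneg
  exact ⟨C, hC⟩

theorem IsState.tensorPow {A B : Type} [Fintype A] [Fintype B] {ρ : Matrix (A × B) (A × B) ℂ}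
    (hρ : IsState ρ) (n : ℕ) : IsState (tensorPow ρ n) := by
  refine ⟨?_, by rw [trace_tensorPow, hρ.2, one_pow]⟩
  obtain ⟨C, hC⟩ := exists_eq_mul_conjTranspose hρ.1
  have : _root_.tensorPow ρ n = _root_.tensorPow C n * (_root_.tensorPow C n).conjTranspose := by
    ext i j
    have := sum_prod_pairs n (fun t c => C (i.1 t, i.2 t) c * star (C (j.1 t, j.2 t) c))
    simp only [hC, _root_.tensorPow, Matrix.mul_apply, Matrix.conjTranspose_apply, star_prod,
      ← Finset.prod_mul_distrib]
    exact this.symm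
  rw [this]
  exact Matrix.posSemidef_self_mul_conjTranspose _

/-- Discarding copies: the distillable entanglement of tensor powers is nondecreasing. -/
theorem pade_tensorPow_mono {A B : Type} [Fintype A] [DecidableEq A] [Fintype B] [DecidableEq B]
    {ρ : Matrix (A × B) (A × B) ℂ} (hρ : ρ.trace = 1) (ε : ℝ) :
    Monotone fun n => pade ε (tensorPow ρ n) := by
  intro n m h
  obtain ⟨k, rfl⟩ := Nat.exists_eq_add_of_le h
  refine pade_partialTrace_le ε (Fin.appendEquiv n k).symm (Fin.appendEquiv n k).symm _ _ ?_
  intro i i'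
  have := trace_tensorPow ρ k
  rw [hρ, one_pow, Matrix.trace, Fintype.sum_prod_type] at this
  simp only [Matrix.diag_apply, tensorPow] at this
  simp only [tensorPow, Equiv.symm_symm, Fin.appendEquiv, Equiv.coe_fn_mk, Fin.prod_univ_add,
    Fin.append_left, Fin.append_right, ← Finset.mul_sum, this, mul_one]

/-- The identification of `n` blocks of length `ℓ` with sequences of length `ℓ * n`. -/
def blockEquiv (A : Type) (ℓ n : ℕ) : (Fin n → Fin ℓ → A) ≃ (Fin (ℓ * n) → A) :=
  (Equiv.curry (Fin n) (Fin ℓ) A).symm.trans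
    (Equiv.arrowCongr (finProdFinEquiv.trans (finCongr (mul_comm n ℓ))) (Equiv.refl A))

theorem pade_tensorPow_tensorPow {A B : Type} [Fintype A] [DecidableEq A] [Fintype B]
    [DecidableEq B] (ρ : Matrix (A × B) (A × B) ℂ) (ε : ℝ) (ℓ n : ℕ) :
    pade ε (tensorPow (tensorPow ρ ℓ) n) = pade ε (tensorPow ρ (ℓ * n)) := by
  rw [← pade_submatrix ε (blockEquiv A ℓ n) (blockEquiv B ℓ n)]
  congr 1
  ext i j
  simp only [tensorPow, Matrix.submatrix_apply]
  rw [← Equiv.prod_comp (finProdFinEquiv.trans (finCongr (mul_comm n ℓ))),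
    Fintype.prod_prod_type]
  simp [blockEquiv]

/-! ### Fidelity with a pure state -/

theorem psdSqrt_mul_self_eq {A : Type} [Fintype A] [DecidableEq A] {S : Matrix A A ℂ}
    (h : S.PosSemidef) : psdSqrt (S * S) = S := by
  have h1 : IsSelfAdjoint S := h.1
  rw [psdSqrt, ← pow_two, ← cfc_comp_pow _ _ _ (by fun_prop)]
  conv_rhs => rw [← cfc_id ℝ S]
  apply cfc_congr
  intro x hx
  rw [h.1.spectrum_real_eq_range_eigenvalues] at hx
  obtain ⟨i, rfl⟩ := hx
  exact Real.sqrt_sq (h.eigenvalues_nonneg i)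

theorem psdSqrt_mul_psdSqrt {A : Type} [Fintype A] [DecidableEq A] {ω : Matrix A A ℂ}
    (h : ω.PosSemidef) : psdSqrt ω * psdSqrt ω = ω := by
  have h1 : IsSelfAdjoint ω := h.1
  rw [psdSqrt, ← cfc_mul _ _ _ (by fun_prop) (by fun_prop)]
  conv_rhs => rw [← cfc_id ℝ ω]
  apply cfc_congr
  intro x hx
  rw [h.1.spectrum_real_eq_range_eigenvalues] at hx
  obtain ⟨i, rfl⟩ := hx
  exact Real.mul_self_sqrt (h.eigenvalues_nonneg i)

theorem psdSqrt_isHermitian {A : Type} [Fintype A] [DecidableEq A] (ω : Matrix A A ℂ) :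
    (psdSqrt ω).conjTranspose = psdSqrt ω :=
  cfc_predicate (p := IsSelfAdjoint) Real.sqrt ω

/-- The fidelity with a pure state is the expectation value of its projector. -/
theorem fidelity_vecMulVec {A : Type} [Fintype A] [DecidableEq A] {ω : Matrix A A ℂ}
    (h : ω.PosSemidef) {v : A → ℂ} (hv : star v ⬝ᵥ v = 1) :
    fidelity ω (Matrix.vecMulVec v (star v)) = (star v ⬝ᵥ ω.mulVec v).re := by
  set P := Matrix.vecMulVec v (star v) with hP
  have hPP : P * P = P := by
    rw [hP, Matrix.vecMulVec_mul_vecMulVec, hv, one_smul]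
  have hPpsd : P.PosSemidef := Matrix.posSemidef_vecMulVec_self_star v
  have hPH : P.conjTranspose = P := hPpsd.1
  have hsP : psdSqrt P = P := by
    conv_lhs => rw [← hPP]
    exact psdSqrt_mul_self_eq hPpsd
  have htr : P.trace = 1 := by
    rw [hP, Matrix.trace_vecMulVec, dotProduct_comm, hv]
  have hc0 := h.dotProduct_mulVec_nonneg v
  -- With `c = ⟨v|ω|v⟩`, `(√ω P)† (√ω P) = P ω P = c P`, whose square root `√c P` has trace `√c`.
  set c := star v ⬝ᵥ ω.mulVec v with hc
  have hcr : c = (c.re : ℂ) := Complex.eq_re_of_ofReal_le hc0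
  have hr0 : 0 ≤ c.re := (Complex.le_def.1 hc0).1
  have hM : (psdSqrt ω * P).conjTranspose * (psdSqrt ω * P)
      = ((Real.sqrt c.re : ℂ) • P) * ((Real.sqrt c.re : ℂ) • P) := by
    rw [Matrix.conjTranspose_mul, psdSqrt_isHermitian, hPH, Matrix.mul_assoc,
      ← Matrix.mul_assoc (psdSqrt ω), psdSqrt_mul_psdSqrt h, Matrix.smul_mul, Matrix.mul_smul, hPP,
      smul_smul, ← Complex.ofReal_mul, Real.mul_self_sqrt hr0, ← hcr, hP, Matrix.mul_vecMulVec,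
      Matrix.vecMulVec_mul_vecMulVec, Matrix.vecMulVec_smul]
  rw [fidelity, hsP, traceNorm, hM, psdSqrt_mul_self_eq
    (hPpsd.smul (Complex.zero_le_real.2 (Real.sqrt_nonneg _))), Matrix.trace_smul, htr]
  simp [Real.sq_sqrt hr0]

theorem star_maxEntVec_dotProduct {d : ℕ} (hd : 1 ≤ d) :
    star (maxEntVec d) ⬝ᵥ maxEntVec d = 1 := by
  have h0 : (0 : ℝ) < d := by exact_mod_cast hd
  have : (((Real.sqrt d)⁻¹ : ℝ) : ℂ) * (((Real.sqrt d)⁻¹ : ℝ) : ℂ) = ((d : ℝ)⁻¹ : ℝ) := by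
    rw [← Complex.ofReal_mul, ← mul_inv, Real.mul_self_sqrt h0.le]
  simp only [dotProduct, Fintype.sum_prod_type, maxEntVec, Pi.star_apply]
  have h2 : ∀ x : Fin d, ∑ y : Fin d, star (if x = y then (((Real.sqrt d)⁻¹ : ℝ) : ℂ) else 0)
      * (if x = y then (((Real.sqrt d)⁻¹ : ℝ) : ℂ) else 0) = ((d : ℝ)⁻¹ : ℝ) := by
    intro x
    rw [Fintype.sum_eq_single x (fun y hy => by simp [hy.symm])]
    rw [← this]
    simp
  simp only [h2]
  have h3 : (d : ℂ) ≠ 0 := by exact_mod_cast h0.ne'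
  simp [h3]

theorem star_maxEntVec_dotProduct_apply {d : ℕ} (w : Fin d × Fin d → ℂ) :
    star (maxEntVec d) ⬝ᵥ w = (((Real.sqrt d)⁻¹ : ℝ) : ℂ) * ∑ i, w (i, i) := by
  simp only [dotProduct, Fintype.sum_prod_type, maxEntVec, Pi.star_apply, Finset.mul_sum]
  refine Finset.sum_congr rfl fun x _ => ?_
  rw [Fintype.sum_eq_single x (fun y hy => by simp [hy.symm])]
  simp

/-! ### Overlap of low-rank vectors with the maximally entangled vector -/

theorem exists_range_projection {d : ℕ} (W : Matrix (Fin d) (Fin d) ℂ) :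
    ∃ P : Matrix (Fin d) (Fin d) ℂ, P.conjTranspose = P ∧ P * P = P ∧ P * W = W ∧
      P.trace = W.rank := by
  let T := Matrix.toEuclideanCLM (n := Fin d) (𝕜 := ℂ)
  let b := (EuclideanSpace.basisFun (Fin d) ℂ).toBasis
  let U : Submodule ℂ (EuclideanSpace ℂ (Fin d)) := LinearMap.range (T W).toLinearMap
  have hT : ∀ M, (T M).toLinearMap = Matrix.toLin b b M := fun M => by
    rw [← Matrix.toEuclideanLin_eq_toLin_orthonormal]
    rfl
  obtain ⟨P, hP⟩ : ∃ P, T P = U.starProjection := EquivLike.surjective T _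
  refine ⟨P, EquivLike.injective T ?_, EquivLike.injective T ?_, EquivLike.injective T ?_, ?_⟩
  · rw [← Matrix.star_eq_conjTranspose, map_star, hP]
    exact isSelfAdjoint_starProjection U
  · rw [map_mul, hP]
    exact U.isIdempotentElem_starProjection
  · rw [map_mul, hP]
    ext1 x
    exact Submodule.starProjection_eq_self_iff.2 ⟨x, rfl⟩
  · have hproj : LinearMap.IsProj U (U.starProjection).toLinearMap :=
      ⟨fun x => U.starProjection_apply_mem x, fun x hx => Submodule.starProjection_eq_self_iff.2 hx⟩
    have h1 := hproj.trace
    rw [← hP, hT, LinearMap.trace_eq_matrix_trace ℂ b, LinearMap.toMatrix_toLin] at h1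
    rw [h1, Matrix.rank_eq_finrank_range_toLin W b b, ← hT]

/-- Since `W = P W` for the projection `P` onto the range of `W`, the Cauchy–Schwarz inequality for
the Hilbert–Schmidt product bounds `|Tr (P W)|²` by `‖P‖₂² ‖W‖₂²`, and `‖P‖₂² = Tr P`. -/
theorem norm_trace_sq_le {d : ℕ} (W : Matrix (Fin d) (Fin d) ℂ) :
    ‖W.trace‖ ^ 2 ≤ W.rank * ∑ i, ∑ j, ‖W i j‖ ^ 2 := by
  obtain ⟨P, hPH, hPP, hPW, htr⟩ := exists_range_projection W
  have hP : ∑ i, ∑ j, ‖P i j‖ ^ 2 = W.rank := by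
    have h1 : ((∑ i, ∑ j, ‖P i j‖ ^ 2 : ℝ) : ℂ) = (P * P.conjTranspose).trace := by
      simp [Matrix.trace, Matrix.mul_apply, Complex.mul_conj']
    rw [hPH, hPP, htr] at h1
    exact_mod_cast h1
  have h2 : ‖W.trace‖ ≤ ∑ x : Fin d × Fin d, ‖P x.1 x.2‖ * ‖W x.2 x.1‖ := by
    conv_lhs => rw [← hPW]
    rw [Matrix.trace, Fintype.sum_prod_type]
    simp only [Matrix.diag_apply, Matrix.mul_apply, ← norm_mul]
    exact (norm_sum_le _ _).trans (Finset.sum_le_sum fun i _ => norm_sum_le _ _)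
  have h3 := Finset.sum_mul_sq_le_sq_mul_sq Finset.univ (fun x : Fin d × Fin d => ‖P x.1 x.2‖)
    (fun x => ‖W x.2 x.1‖)
  rw [Fintype.sum_prod_type (f := fun x : Fin d × Fin d => ‖P x.1 x.2‖ ^ 2),
    Fintype.sum_prod_type_right (f := fun x : Fin d × Fin d => ‖W x.2 x.1‖ ^ 2), hP] at h3
  exact (pow_le_pow_left₀ (norm_nonneg _) h2 2).trans h3

/-- The overlap of a vector with `Φ^d` is `d^{-1/2} Tr W`, where the matrix `W` holds the coordinates
of the vector; `W.rank` is its Schmidt rank. -/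
theorem normSq_overlap_le {d : ℕ} (W : Matrix (Fin d) (Fin d) ℂ) :
    ‖star (maxEntVec d) ⬝ᵥ (fun i => W i.1 i.2)‖ ^ 2 ≤ W.rank / d * ∑ i, ∑ j, ‖W i j‖ ^ 2 := by
  have h := norm_trace_sq_le W
  rw [star_maxEntVec_dotProduct_apply, norm_mul, mul_pow, Complex.norm_real, Real.norm_eq_abs,
    sq_abs, inv_pow, Real.sq_sqrt (Nat.cast_nonneg d), div_mul_eq_mul_div, inv_mul_eq_div]
  exact div_le_div_of_nonneg_right h (Nat.cast_nonneg d)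

theorem dotProduct_mul_conjTranspose_mulVec {I κ : Type} [Fintype I] [Fintype κ]
    (G : Matrix I κ ℂ) (v : I → ℂ) :
    (star v ⬝ᵥ (G * G.conjTranspose).mulVec v).re = ∑ c, ‖star v ⬝ᵥ fun i => G i c‖ ^ 2 := by
  have h : star v ⬝ᵥ (G * G.conjTranspose).mulVec v
      = ((∑ c, ‖star v ⬝ᵥ fun i => G i c‖ ^ 2 : ℝ) : ℂ) := by
    rw [← Matrix.mulVec_mulVec, Matrix.dotProduct_mulVec, dotProduct]
    push_cast
    refine Finset.sum_congr rfl fun c _ => ?_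
    rw [← Complex.mul_conj']
    congr 1
    simp [Matrix.mulVec, dotProduct, mul_comm]
  rw [h, Complex.ofReal_re]

theorem trace_mul_conjTranspose_re {I κ : Type} [Fintype I] [Fintype κ] (G : Matrix I κ ℂ) :
    (G * G.conjTranspose).trace.re = ∑ c, ∑ i, ‖G i c‖ ^ 2 := by
  have h : (G * G.conjTranspose).trace = ((∑ c, ∑ i, ‖G i c‖ ^ 2 : ℝ) : ℂ) := by
    rw [Finset.sum_comm]
    simp [Matrix.trace, Matrix.mul_apply, Complex.mul_conj']
  rw [h, Complex.ofReal_re]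

/-- A product Kraus operator applied to a positive operator on `ℂ^A ⊗ ℂ^B` yields a mixture of
vectors of Schmidt rank at most `min (dim A) (dim B)`, hence a bounded overlap with `Φ^d`. -/
theorem overlap_kronecker_le {A B : Type} [Fintype A] [Fintype B] {d : ℕ}
    {X : Matrix (A × B) (A × B) ℂ} (hX : X.PosSemidef) (K : Matrix (Fin d) A ℂ)
    (L : Matrix (Fin d) B ℂ) :
    (star (maxEntVec d) ⬝ᵥ ((K ⊗ₖ L) * X * (K ⊗ₖ L).conjTranspose).mulVec (maxEntVec d)).re
      ≤ (min (Fintype.card A) (Fintype.card B) : ℕ) / d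
        * ((K ⊗ₖ L) * X * (K ⊗ₖ L).conjTranspose).trace.re := by
  obtain ⟨C, rfl⟩ := exists_eq_mul_conjTranspose hX
  have hG : (K ⊗ₖ L) * (C * C.conjTranspose) * (K ⊗ₖ L).conjTranspose
      = ((K ⊗ₖ L) * C) * ((K ⊗ₖ L) * C).conjTranspose := by
    rw [Matrix.conjTranspose_mul]
    simp only [Matrix.mul_assoc]
  rw [hG, dotProduct_mul_conjTranspose_mulVec, trace_mul_conjTranspose_re, Finset.mul_sum]
  refine Finset.sum_le_sum fun c _ => ?_
  -- The `c`-th column, read as a `d × d` matrix, factors through `ℂ^A` and through `ℂ^B`.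
  let V : Matrix A B ℂ := Matrix.of fun a b => C (a, b) c
  have hW : ∀ i j, (K * V * L.transpose) i j = ((K ⊗ₖ L) * C) (i, j) c := fun i j => by
    simp only [Matrix.mul_apply, Matrix.transpose_apply, Matrix.kroneckerMap_apply,
      Fintype.sum_prod_type_right, Finset.sum_mul, V, Matrix.of_apply]
    exact Finset.sum_congr rfl fun b _ => Finset.sum_congr rfl fun a _ => by ring
  have h := normSq_overlap_le (K * V * L.transpose)
  simp only [hW] at h
  rw [Fintype.sum_prod_type]
  refine h.trans (mul_le_mul_of_nonneg_right ?_ (by positivity))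
  refine div_le_div_of_nonneg_right ?_ (Nat.cast_nonneg d)
  refine Nat.cast_le.2 (le_min ?_ ?_)
  · rw [Matrix.mul_assoc]
    exact (Matrix.rank_mul_le_left _ _).trans (Matrix.rank_le_card_width K)
  · exact (Matrix.rank_mul_le_right _ _).trans (Matrix.rank_le_card_height _)

/-! ### Bounds on the distillable entanglement -/

/-- LOCC channels are separable: they have Kraus operators of product form. -/
theorem IsLOCC.exists_product_kraus {A B A' B' : Type} [Fintype A] [DecidableEq A] [Fintype B]
    [DecidableEq B] [Fintype A'] [DecidableEq A'] [Fintype B'] [DecidableEq B']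
    {Λ : Matrix (A × B) (A × B) ℂ → Matrix (A' × B') (A' × B') ℂ} (h : IsLOCC Λ) :
    ∃ (ι : Type) (_ : Fintype ι) (K : ι → Matrix A' A ℂ) (L : ι → Matrix B' B ℂ),
      ∀ X, Λ X = ∑ i, (K i ⊗ₖ L i) * X * (K i ⊗ₖ L i).conjTranspose := by
  have hsum : ∀ {A B A' B' : Type} [Fintype A] [Fintype B] {r s t : ℕ}
      (K : Fin r → Fin s → Matrix A' A ℂ) (L : Fin r → Fin t → Matrix B' B ℂ),
      ∃ (ι : Type) (_ : Fintype ι) (K' : ι → Matrix A' A ℂ) (L' : ι → Matrix B' B ℂ),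
      ∀ X, sumTensorMap K L X = ∑ i, (K' i ⊗ₖ L' i) * X * (K' i ⊗ₖ L' i).conjTranspose := by
    intro A B A' B' _ _ r s t K L
    refine ⟨Fin r × Fin s × Fin t, inferInstance, fun i => K i.1 i.2.1, fun i => L i.1 i.2.2,
      fun X => ?_⟩
    simp only [sumTensorMap, Fintype.sum_prod_type]
  induction h with
  | aliceToBob K L _ _ => exact hsum K L
  | bobToAlice K L _ _ => exact hsum K L
  | comp Λ₂ Λ₁ _ _ ih₂ ih₁ =>
    obtain ⟨ι₂, _, K₂, L₂, h₂⟩ := ih₂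
    obtain ⟨ι₁, _, K₁, L₁, h₁⟩ := ih₁
    refine ⟨ι₂ × ι₁, inferInstance, fun i => K₂ i.1 * K₁ i.2, fun i => L₂ i.1 * L₁ i.2,
      fun X => ?_⟩
    simp only [Function.comp_apply, h₂, h₁, Fintype.sum_prod_type, Matrix.mul_sum, Matrix.sum_mul,
      Matrix.mul_kronecker_mul, Matrix.conjTranspose_mul, Matrix.mul_assoc]

/-- The block of the flagged state at flag value `1` is `p • Φ'`. -/
theorem flaggedState_success {d : ℕ} (p : ℝ) (Φ' σ : Matrix (Fin d × Fin d) (Fin d × Fin d) ℂ) :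
    (flaggedState p Φ' σ).submatrix (fun i => ((1, i.1), i.2)) (fun i => ((1, i.1), i.2))
      = (p : ℂ) • Φ' := by
  ext i j
  simp [flaggedState]

/-- Conditioned on success, the distilled state has fidelity at most `D / d` with `Φ^d`. -/
theorem fidelity_le_of_locc {A B : Type} [Fintype A] [DecidableEq A] [Fintype B] [DecidableEq B]
    {ρ : Matrix (A × B) (A × B) ℂ} (hρ : ρ.PosSemidef) {d : ℕ} (hd : 1 ≤ d) {p : ℝ} (hp : 0 < p)
    {Λ : Matrix (A × B) (A × B) ℂ → Matrix ((Fin 2 × Fin d) × Fin d) ((Fin 2 × Fin d) × Fin d) ℂ}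
    (hΛ : IsLOCC Λ) {Φ' σ : Matrix (Fin d × Fin d) (Fin d × Fin d) ℂ} (hΦ : IsState Φ')
    (h : Λ ρ = flaggedState p Φ' σ) :
    fidelity Φ' (maxEnt d) ≤ (min (Fintype.card A) (Fintype.card B) : ℕ) / d := by
  obtain ⟨ι, _, K, L, hKL⟩ := hΛ.exists_product_kraus
  have hp' : (p : ℂ) • Φ' = ∑ i, ((K i).submatrix (fun a => (1, a)) id ⊗ₖ L i) * ρ
      * ((K i).submatrix (fun a => (1, a)) id ⊗ₖ L i).conjTranspose := by
    rw [← flaggedState_success p Φ' σ, ← h, hKL]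
    ext i j
    simp only [Matrix.submatrix_apply, Matrix.sum_apply]
    rfl
  have key : ((star (maxEntVec d)) ⬝ᵥ ((p : ℂ) • Φ').mulVec (maxEntVec d)).re
      ≤ (min (Fintype.card A) (Fintype.card B) : ℕ) / d * ((p : ℂ) • Φ').trace.re := by
    rw [hp', Matrix.sum_mulVec, dotProduct_sum, Complex.re_sum, Matrix.trace_sum, Complex.re_sum,
      Finset.mul_sum]
    exact Finset.sum_le_sum fun i _ => overlap_kronecker_le hρ _ _
  rw [Matrix.smul_mulVec, dotProduct_smul, smul_eq_mul, Complex.re_ofReal_mul, Matrix.trace_smul,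
    hΦ.2, smul_eq_mul, mul_one, Complex.ofReal_re, mul_comm] at key
  rw [maxEnt, fidelity_vecMulVec hΦ.1 (star_maxEntVec_dotProduct hd)]
  exact le_of_mul_le_mul_right key hp

theorem IsState.one_le_min_card {A B : Type} [Fintype A] [Fintype B]
    {ρ : Matrix (A × B) (A × B) ℂ} (hρ : IsState ρ) :
    1 ≤ min (Fintype.card A) (Fintype.card B) := by
  have : Nonempty (A × B) := by
    by_contra hne
    rw [not_nonempty_iff] at hne
    have := hρ.2
    simp [Matrix.trace] at this
  obtain ⟨a, b⟩ := this
  exact le_min (Fintype.card_pos_iff.2 ⟨a⟩) (Fintype.card_pos_iff.2 ⟨b⟩)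

theorem logb_one_div_one_sub_nonneg {ε : ℝ} (hε : ε ∈ Set.Ioo (0 : ℝ) 1) :
    0 ≤ Real.logb 2 (1 / (1 - ε)) := by
  obtain ⟨h0, h1⟩ := hε
  refine Real.logb_nonneg (by norm_num) ?_
  rw [le_div_iff₀ (by linarith)]
  linarith

theorem pade_le {A B : Type} [Fintype A] [DecidableEq A] [Fintype B] [DecidableEq B]
    {ρ : Matrix (A × B) (A × B) ℂ} (hρ : IsState ρ) {ε : ℝ} (hε : ε ∈ Set.Ioo (0 : ℝ) 1) :
    pade ε ρ ≤ ((Real.logb 2 ((min (Fintype.card A) (Fintype.card B) : ℕ) : ℝ)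
        + Real.logb 2 (1 / (1 - ε)) : ℝ) : EReal) := by
  have hε' := logb_one_div_one_sub_nonneg hε
  obtain ⟨h0, h1⟩ := hε
  set D := min (Fintype.card A) (Fintype.card B) with hD
  have hD1 : (1 : ℝ) ≤ D := by exact_mod_cast hρ.one_le_min_card
  refine sSup_le ?_
  rintro e ⟨p, d, Λ, Φ', σ, hp0, hp1, hd, hΛ, hΦ, hσ, h, hF, rfl⟩
  refine EReal.coe_le_coe_iff.2 ?_
  have hd1 : (1 : ℝ) ≤ d := by exact_mod_cast hd
  have hlogD : 0 ≤ Real.logb 2 (D : ℝ) := Real.logb_nonneg (by norm_num) hD1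
  rcases hp0.eq_or_lt with rfl | hp
  · rw [zero_mul]
    positivity
  have hle := hF.trans (fidelity_le_of_locc hρ.1 hd hp hΛ hΦ h)
  have hdD : (d : ℝ) ≤ D * (1 / (1 - ε)) := by
    rw [le_div_iff₀ (by linarith)] at hle
    rw [mul_one_div, le_div_iff₀ (by linarith)]
    linarith
  rw [← Real.logb_mul (by positivity) (by have : 1 - ε ≠ 0 := by linarith
                                          positivity)]
  calc p * Real.logb 2 d ≤ 1 * Real.logb 2 d :=
        mul_le_mul_of_nonneg_right hp1 (Real.logb_nonneg (by norm_num) hd1)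
    _ = Real.logb 2 d := one_mul _
    _ ≤ _ := Real.logb_le_logb_of_le (by norm_num) (by linarith) hdD

theorem fidelity_maxEnt_self {d : ℕ} (hd : 1 ≤ d) : fidelity (maxEnt d) (maxEnt d) = 1 := by
  have h := star_maxEntVec_dotProduct hd
  have hpsd : (maxEnt d).PosSemidef := Matrix.posSemidef_vecMulVec_self_star _
  conv_lhs => rw [show fidelity (maxEnt d) (maxEnt d) = fidelity (maxEnt d)
    (Matrix.vecMulVec (maxEntVec d) (star (maxEntVec d))) from rfl]
  rw [fidelity_vecMulVec hpsd h, maxEnt, Matrix.vecMulVec_mulVec, h]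
  simp [h]

/-- Discarding everything and preparing the product state `Φ^1` with certainty distils
`log₂ 1 = 0`. -/
theorem pade_nonneg {A B : Type} [Fintype A] [DecidableEq A] [Fintype B] [DecidableEq B]
    {ρ : Matrix (A × B) (A × B) ℂ} (hρ : ρ.trace = 1) {ε : ℝ} (hε : 0 ≤ ε) : 0 ≤ pade ε ρ := by
  let K : Fin 1 → Fin (Fintype.card A) → Matrix (Fin 2 × Fin 1) A ℂ :=
    fun _ j => Matrix.single (1, 0) ((Fintype.equivFin A).symm j) 1
  let L : Fin 1 → Fin (Fintype.card B) → Matrix (Fin 1) B ℂ :=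
    fun _ j => Matrix.single 0 ((Fintype.equivFin B).symm j) 1
  have hK : IsInstrument K := by
    simp only [IsInstrument, K, Finset.univ_unique, Finset.sum_singleton,
      Matrix.conjTranspose_single, Matrix.single_mul_single_same, star_one, mul_one]
    rw [Equiv.sum_comp (Fintype.equivFin A).symm (fun a => Matrix.single a a (1 : ℂ))]
    exact Matrix.sum_single_one
  have hL : ∀ x, IsChannel (L x) := fun _ => by
    simp only [IsChannel, L, Matrix.conjTranspose_single, Matrix.single_mul_single_same, star_one,
      mul_one]
    rw [Equiv.sum_comp (Fintype.equivFin B).symm (fun a => Matrix.single a a (1 : ℂ))]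
    exact Matrix.sum_single_one
  have hst : IsState (maxEnt 1) := by
    refine ⟨Matrix.posSemidef_vecMulVec_self_star _, ?_⟩
    rw [maxEnt, Matrix.trace_vecMulVec, dotProduct_comm, star_maxEntVec_dotProduct le_rfl]
  refine le_sSup ⟨1, 1, sumTensorMap K L, maxEnt 1, maxEnt 1, zero_le_one, le_rfl, le_rfl,
    IsLOCC.aliceToBob K L hK hL, hst, hst, ?_, ?_, by simp⟩
  · have htr : ∑ j, ∑ k, ρ ((Fintype.equivFin A).symm j, (Fintype.equivFin B).symm k)
        ((Fintype.equivFin A).symm j, (Fintype.equivFin B).symm k) = 1 := by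
      rw [← hρ, Matrix.trace, Fintype.sum_prod_type, ← Equiv.sum_comp (Fintype.equivFin A).symm]
      exact Finset.sum_congr rfl fun j _ =>
        Equiv.sum_comp (Fintype.equivFin B).symm (fun b => ρ (_, b) (_, b))
    have h1 : sumTensorMap K L ρ = Matrix.single ((1, 0), 0) ((1, 0), 0) 1 := by
      simp only [sumTensorMap, Finset.univ_unique, Finset.sum_singleton, K, L,
        Matrix.single_kronecker_single, Matrix.conjTranspose_single, Matrix.single_mul_mul_single,
        star_one, mul_one, one_mul]
      rw [← htr]
      simp only [← Matrix.singleAddMonoidHom_apply, map_sum]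
    rw [h1]
    ext ⟨⟨x, i⟩, j⟩ ⟨⟨x', i'⟩, j'⟩
    fin_cases x <;> fin_cases x' <;> fin_cases i <;> fin_cases i' <;> fin_cases j <;>
      fin_cases j' <;>
      simp [flaggedState, maxEnt, maxEntVec, Matrix.vecMulVec_apply]
  · rw [fidelity_maxEnt_self le_rfl]
    linarith

/-! ### Regularization along blocks -/

theorem pade_tensorPow_le {A B : Type} [Fintype A] [DecidableEq A] [Fintype B] [DecidableEq B]
    {ρ : Matrix (A × B) (A × B) ℂ} (hρ : IsState ρ) {ε : ℝ} (hε : ε ∈ Set.Ioo (0 : ℝ) 1) {n : ℕ}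
    (hn : 1 ≤ n) :
    pade ε (tensorPow ρ n) ≤
      (((Real.logb 2 ((min (Fintype.card A) (Fintype.card B) : ℕ) : ℝ)
        + Real.logb 2 (1 / (1 - ε))) * n : ℝ) : EReal) := by
  refine (pade_le (hρ.tensorPow n) hε).trans (EReal.coe_le_coe_iff.2 ?_)
  have hε' := logb_one_div_one_sub_nonneg hε
  have hn' : (1 : ℝ) ≤ n := by exact_mod_cast hn
  have hcard : min (Fintype.card (Fin n → A)) (Fintype.card (Fin n → B))
      = min (Fintype.card A) (Fintype.card B) ^ n := by
    simp only [Fintype.card_fun, Fintype.card_fin]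
    exact ((pow_left_mono n).map_min).symm
  rw [hcard, Nat.cast_pow, Real.logb_pow, add_mul, mul_comm (n : ℝ)]
  exact add_le_add le_rfl (le_mul_of_one_le_right hε' hn')

/-- Regularizing along blocks of length `ℓ`: monotonicity and the linear growth bound place
`n ↦ pade ε (tensorPow ρ n)` within the scope of `regularized_multiples`. -/
theorem regularized_pade_blocks {A B : Type} [Fintype A] [DecidableEq A] [Fintype B]
    [DecidableEq B] {ρ : Matrix (A × B) (A × B) ℂ} (hρ : IsState ρ) {ℓ : ℕ} (hℓ : 1 ≤ ℓ) {ε : ℝ}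
    (hε : ε ∈ Set.Ioo (0 : ℝ) 1) :
    liminf (fun n : ℕ => ((1 / (n : ℝ) : ℝ) : EReal) * pade ε (tensorPow ρ n)) atTop
      = ((1 / (ℓ : ℝ) : ℝ) : EReal) * liminf (fun n : ℕ => ((1 / (n : ℝ) : ℝ) : EReal) *
          pade ε (tensorPow (tensorPow ρ ℓ) n)) atTop ∧
    limsup (fun n : ℕ => ((1 / (n : ℝ) : ℝ) : EReal) * pade ε (tensorPow ρ n)) atTop
      = ((1 / (ℓ : ℝ) : ℝ) : EReal) * limsup (fun n : ℕ => ((1 / (n : ℝ) : ℝ) : EReal) *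
          pade ε (tensorPow (tensorPow ρ ℓ) n)) atTop := by
  simp only [pade_tensorPow_tensorPow]
  have hD : (1 : ℝ) ≤ (min (Fintype.card A) (Fintype.card B) : ℕ) := by
    exact_mod_cast hρ.one_le_min_card
  exact regularized_multiples (pade_tensorPow_mono hρ.2 ε)
    (fun n => pade_nonneg (hρ.tensorPow n).2 hε.1.le) (fun n hn => pade_tensorPow_le hρ hε hn)
    (add_nonneg (Real.logb_nonneg (by norm_num) hD) (logb_one_div_one_sub_nonneg hε)) hℓ

theorem theorem4 {A B : Type} [Fintype A] [DecidableEq A] [Fintype B] [DecidableEq B]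
    (ρ : Matrix (A × B) (A × B) ℂ) (hρ : IsState ρ) :
    (∀ ε ∈ Set.Ioo (0 : ℝ) 1,
      0 ≤ pade ε ρ ∧
      pade ε ρ ≤ ((Real.logb 2 ((min (Fintype.card A) (Fintype.card B) : ℕ) : ℝ)
        + Real.logb 2 (1 / (1 - ε)) : ℝ) : EReal)) ∧
    ∀ ℓ : ℕ, 1 ≤ ℓ →
      (∀ ε ∈ Set.Ioo (0 : ℝ) 1,
        liminf (fun n : ℕ => ((1 / (n : ℝ) : ℝ) : EReal) * pade ε (tensorPow ρ n)) atTop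
          = ((1 / (ℓ : ℝ) : ℝ) : EReal) *
            liminf (fun n : ℕ => ((1 / (n : ℝ) : ℝ) : EReal) *
              pade ε (tensorPow (tensorPow ρ ℓ) n)) atTop ∧
        limsup (fun n : ℕ => ((1 / (n : ℝ) : ℝ) : EReal) * pade ε (tensorPow ρ n)) atTop
          = ((1 / (ℓ : ℝ) : ℝ) : EReal) *
            limsup (fun n : ℕ => ((1 / (n : ℝ) : ℝ) : EReal) *
              pade ε (tensorPow (tensorPow ρ ℓ) n)) atTop) ∧
      asympPade ρ = ((1 / (ℓ : ℝ) : ℝ) : EReal) * asympPade (tensorPow ρ ℓ) ∧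
      strongConversePade ρ = ((1 / (ℓ : ℝ) : ℝ) : EReal) * strongConversePade (tensorPow ρ ℓ) := by
  refine ⟨fun ε hε => ⟨pade_nonneg hρ.2 hε.1.le, pade_le hρ hε⟩, fun ℓ hℓ =>
    ⟨fun ε hε => regularized_pade_blocks hρ hℓ hε, ?_, ?_⟩⟩
  -- Multiplication by `1 / ℓ` is an order automorphism, so it passes through `⨅` and `⨆` over `ε`.
  · have hc : (0 : ℝ) < 1 / ℓ := by positivity
    rw [← erealMulLeft_apply _ hc, asympPade, asympPade]
    simp only [OrderIso.map_iInf, erealMulLeft_apply]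
    exact iInf_congr fun ε => iInf_congr fun hε => (regularized_pade_blocks hρ hℓ hε).1
  · have hc : (0 : ℝ) < 1 / ℓ := by positivity
    rw [← erealMulLeft_apply _ hc, strongConversePade, strongConversePade]
    simp only [OrderIso.map_iSup, erealMulLeft_apply]
    exact iSup_congr fun ε => iSup_congr fun hε => (regularized_pade_blocks hρ hℓ hε).2
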